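/- Let $S$ be a scheme and let $d_0, d_1 : T_1 \rightrightarrows T_0$ be morphisms of $S$-schemes forming an equivalence relation on $T_0$: the morphism $d = (d_0, d_1) : T_1 \to T_0 \times_S T_0$ is a monomorphism and, for every $S$-scheme $X$, the image of $T_1(X)$ in $T_0(X) \times T_0(X)$ is an equivalence relation on $T_0(X)$. Let $\varepsilon : T_0 \to T_1$ be the reflexivity morphism, that is, the unique $S$-morphism such that $d \circ \varepsilon$ is the diagonal of $T_0$ over $S$. Assume that $\varepsilon$ is schematically dominant, i.e. $\mathcal{O}_{T_1} \to \varepsilon_* \mathcal{O}_{T_0}$ is injective, and that $d_0$ and $d_1$ are local isomorphisms (a morphism $f : X \to Y$ is a local isomorphism if every point of $X$ has an open neighbourhood $U$ such that $f|_U : U \to Y$ is an open immersion). Then the quotient sheaf $\widetilde{T_0/T_1}$, i.e. the sheaf associated with the presheaf $X \mapsto T_0(X)/T_1(X)$ for the fppf topology on the category of $S$-schemes, is represented by an $S$-scheme $E$, and the canonical morphism $h : T_0 \to E$ is a local isomorphism. If, moreover, $d_0$ and $d_1$ are quasi-compact, then $h$ is quasi-compact. -/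

import Mathlib

open CategoryTheory AlgebraicGeometry Opposite

universe u

namespace SchemeQuotient

/-- A morphism of schemes `t : Y ⟶ X` is schematically dominant if the morphism of sheaves
`𝒪_X ⟶ t_* 𝒪_Y` is injective, that is, injective on sections over every open of `X`.
No quasi-compactness of `t` is required. -/
def SchematicallyDominant {Y X : Scheme.{u}} (t : Y ⟶ X) : Prop :=
  ∀ U : X.Opens, Function.Injective (t.app U)

variable {S : Scheme.{u}} {T₀ T₁ : Over S}

/-- The relation on the set `T₀(X)` of `X`-valued points over `S` induced by a pair of morphisms
`d₀, d₁ : T₁ ⟶ T₀` of `S`-schemes. -/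
def pointRel (d₀ d₁ : T₁ ⟶ T₀) (X : Over S) (a b : X ⟶ T₀) : Prop :=
  ∃ r : X ⟶ T₁, r ≫ d₀ = a ∧ r ≫ d₁ = b

/-- The presheaf quotient `X ↦ T₀(X) / T₁(X)` on the category of `S`-schemes. -/
def quotientPresheaf (d₀ d₁ : T₁ ⟶ T₀) : (Over S)ᵒᵖ ⥤ Type u where
  obj X := Quot (pointRel d₀ d₁ X.unop)
  map f := ↾(Quot.map (fun a => f.unop ≫ a) (by
    rintro a b ⟨r, rfl, rfl⟩
    exact ⟨f.unop ≫ r, by simp, by simp⟩))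
  map_id X := by
    ext x
    induction x using Quot.ind with
    | mk a => exact congrArg (Quot.mk _) (Category.id_comp a)
  map_comp f g := by
    ext x
    induction x using Quot.ind with
    | mk a => exact congrArg (Quot.mk _) (Category.assoc g.unop f.unop a)

/-- The presheaf quotient with values in `Type (u + 1)`, where sheafification on the large site of
all `S`-schemes is available. -/
abbrev quotientPresheafLarge (d₀ d₁ : T₁ ⟶ T₀) : (Over S)ᵒᵖ ⥤ Type (u + 1) :=
  quotientPresheaf d₀ d₁ ⋙ uliftFunctor.{u + 1, u}

/-- The fppf topology on the category of `S`-schemes. -/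
abbrev fppfOver (S : Scheme.{u}) : GrothendieckTopology (Over S) :=
  Scheme.fppfTopology.over S

/-- The fppf quotient sheaf `T₀ / T₁`: the sheaf associated with `X ↦ T₀(X) / T₁(X)` for the fppf
topology on `S`-schemes. -/
noncomputable def fppfQuotient (d₀ d₁ : T₁ ⟶ T₀) : Sheaf (fppfOver S) (Type (u + 1)) :=
  (presheafToSheaf (fppfOver S) (Type (u + 1))).obj (quotientPresheafLarge d₀ d₁)

/-- The class of the universal point `𝟙 T₀` in the fppf quotient; by Yoneda, it is the canonical
morphism from (the sheaf represented by) `T₀` to the fppf quotient. -/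
noncomputable def fppfQuotientClass (d₀ d₁ : T₁ ⟶ T₀) :
    (fppfQuotient d₀ d₁).obj.obj (op T₀) :=
  (toSheafify (fppfOver S) (quotientPresheafLarge d₀ d₁)).app (op T₀)
    (ULift.up (Quot.mk (pointRel d₀ d₁ T₀) (𝟙 T₀)))

/-- If `E` represents the fppf quotient `T₀ / T₁`, the canonical morphism `h : T₀ ⟶ E`. -/
noncomputable def canonicalMap (d₀ d₁ : T₁ ⟶ T₀) {E : Over S}
    (ρ : (fppfQuotient d₀ d₁).obj.RepresentableBy E) : T₀ ⟶ E :=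
  ρ.homEquiv.symm (fppfQuotientClass d₀ d₁)

end SchemeQuotient

/-! For opens `U`, `V` of `X`, consider the part of the relation lying over `U` by `d₀` and over `V`
by `d₁`. For `U = V` affine the two projections coincide: they are equalised by the diagonal, and
schematic dominance makes pullback of functions along it injective, which suffices for maps into an
affine scheme (`overlapFst_eq_overlapSnd`). By transitivity the overlap then projects
monomorphically to `U` when `V` is affine (`overlap_hom_ext`). A monomorphism that is a local
isomorphism is an open immersion, so the affine opens glue along their overlaps to a scheme `E`, and
`h : X ⟶ E` is a surjective local isomorphism with kernel pair the relation
(`exists_isPullback_isLocalIso`). Such an `h` is an fppf covering, hence `E` represents the quotient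
sheaf. Quasi-compactness descends because `h` becomes a base change of `d₁` over each chart. -/

open Limits

/-! ### Calculus of points of an equivalence relation -/

namespace CategoryTheory.EquivalenceRelation

variable {C : Type*} [Category* C] {T X : C} {d₀ d₁ : T ⟶ X} (e : EquivalenceRelation d₀ d₁)

include e in
lemma hom_ext {Y : C} {f g : Y ⟶ T} (h₀ : f ≫ d₀ = g ≫ d₀) (h₁ : f ≫ d₁ = g ≫ d₁) : f = g :=
  e.right_cancellation f g h₀ h₁

/-- Composition of two points of an equivalence relation. -/
noncomputable def trans {Y : C} (a b : Y ⟶ T) (h : a ≫ d₁ = b ≫ d₀) : Y ⟶ T :=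
  PullbackCone.IsLimit.lift e.isLimit a b h ≫ e.t

@[simp]
lemma s_fst : e.s ≫ d₀ = d₁ := e.symmetry₁

@[simp]
lemma s_snd : e.s ≫ d₁ = d₀ := e.symmetry₂

@[simp]
lemma trans_fst {Y : C} (a b : Y ⟶ T) (h : a ≫ d₁ = b ≫ d₀) : e.trans a b h ≫ d₀ = a ≫ d₀ := by
  simp [trans, e.toTransitiveRelation.transitivity₁]

@[simp]
lemma trans_snd {Y : C} (a b : Y ⟶ T) (h : a ≫ d₁ = b ≫ d₀) : e.trans a b h ≫ d₁ = b ≫ d₁ := by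
  simp [trans, e.toTransitiveRelation.transitivity₂]

/-- The image of an equivalence relation under a functor that preserves pullbacks and keeps the two
projections jointly monic. -/
noncomputable def map {D : Type*} [Category* D] (F : C ⥤ D)
    [JointlyMono₂ (F.map d₀) (F.map d₁)] [PreservesLimitsOfShape WalkingCospan F] :
    EquivalenceRelation (F.map d₀) (F.map d₁) where
  __ := e.toReflexiveRelation.map F
  __ := e.toSymmetricRelation.map F
  __ := e.toTransitiveRelation.map F

end CategoryTheory.EquivalenceRelation

namespace SchemeQuotient

lemma flat_of_isLocalIso {X Y : Scheme.{u}} (f : X ⟶ Y) (hf : IsLocalIso f) : Flat f :=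
  have : IsZariskiLocalAtSource @Flat := HasRingHomProperty.instIsZariskiLocalAtSource
  have : MorphismProperty.ContainsIdentities @Flat := ⟨fun _ => inferInstance⟩
  IsLocalIso.le_of_isZariskiLocalAtSource @Flat _ _ _ hf

lemma locallyOfFinitePresentation_of_isLocalIso {X Y : Scheme.{u}} (f : X ⟶ Y)
    (hf : IsLocalIso f) : LocallyOfFinitePresentation f :=
  have : IsZariskiLocalAtSource @LocallyOfFinitePresentation :=
    HasRingHomProperty.instIsZariskiLocalAtSource
  have : MorphismProperty.ContainsIdentities @LocallyOfFinitePresentation :=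
    ⟨fun _ => inferInstance⟩
  IsLocalIso.le_of_isZariskiLocalAtSource @LocallyOfFinitePresentation _ _ _ hf

/-! ### Overlaps of opens in the relation -/

/-- The part of a relation that lies over `U` by the first and over `V` by the second projection. -/
def overlap {T X : Scheme.{u}} (d₀ d₁ : T ⟶ X) (U V : X.Opens) : T.Opens :=
  d₀ ⁻¹ᵁ U ⊓ d₁ ⁻¹ᵁ V

section Overlap

variable {T X : Scheme.{u}} (d₀ d₁ : T ⟶ X)

/-- The first projection of the overlap. -/
noncomputable def overlapFst (U V : X.Opens) : (overlap d₀ d₁ U V).toScheme ⟶ U.toScheme :=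
  d₀.resLE U _ inf_le_left

/-- The second projection of the overlap. -/
noncomputable def overlapSnd (U V : X.Opens) : (overlap d₀ d₁ U V).toScheme ⟶ V.toScheme :=
  d₁.resLE V _ inf_le_right

@[simp]
lemma overlapFst_ι (U V : X.Opens) :
    overlapFst d₀ d₁ U V ≫ U.ι = (overlap d₀ d₁ U V).ι ≫ d₀ :=
  Scheme.Hom.resLE_comp_ι _ _

@[simp]
lemma overlapFst_ι_assoc (U V : X.Opens) {Z : Scheme.{u}} (f : X ⟶ Z) :
    overlapFst d₀ d₁ U V ≫ U.ι ≫ f = (overlap d₀ d₁ U V).ι ≫ d₀ ≫ f := by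
  rw [← Category.assoc, overlapFst_ι, Category.assoc]

@[simp]
lemma overlapSnd_ι (U V : X.Opens) :
    overlapSnd d₀ d₁ U V ≫ V.ι = (overlap d₀ d₁ U V).ι ≫ d₁ :=
  Scheme.Hom.resLE_comp_ι _ _

@[simp]
lemma overlapSnd_ι_assoc (U V : X.Opens) {Z : Scheme.{u}} (f : X ⟶ Z) :
    overlapSnd d₀ d₁ U V ≫ V.ι ≫ f = (overlap d₀ d₁ U V).ι ≫ d₁ ≫ f := by
  rw [← Category.assoc, overlapSnd_ι, Category.assoc]

variable {d₀ d₁} in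
/-- A point of the relation whose projections lie in `U` and `V` is a point of the overlap. -/
noncomputable def overlapLift {U V : X.Opens} {Y : Scheme.{u}} (r : Y ⟶ T) (a : Y ⟶ U.toScheme)
    (b : Y ⟶ V.toScheme) (h₀ : r ≫ d₀ = a ≫ U.ι) (h₁ : r ≫ d₁ = b ≫ V.ι) :
    Y ⟶ (overlap d₀ d₁ U V).toScheme :=
  IsOpenImmersion.lift (overlap d₀ d₁ U V).ι r <| by
    rw [Scheme.Opens.range_ι]
    rintro _ ⟨y, rfl⟩
    refine ⟨?_, ?_⟩
    · change d₀ (r y) ∈ U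
      rw [← Scheme.Hom.comp_apply, h₀, Scheme.Hom.comp_apply]
      exact (a y).2
    · change d₁ (r y) ∈ V
      rw [← Scheme.Hom.comp_apply, h₁, Scheme.Hom.comp_apply]
      exact (b y).2

variable {d₀ d₁} in
@[simp]
lemma overlapLift_ι {U V : X.Opens} {Y : Scheme.{u}} (r : Y ⟶ T) (a : Y ⟶ U.toScheme)
    (b : Y ⟶ V.toScheme) (h₀ : r ≫ d₀ = a ≫ U.ι) (h₁ : r ≫ d₁ = b ≫ V.ι) :
    overlapLift r a b h₀ h₁ ≫ (overlap d₀ d₁ U V).ι = r :=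
  IsOpenImmersion.lift_fac _ _ _

variable {d₀ d₁} in
@[simp]
lemma overlapLift_ι_assoc {U V : X.Opens} {Y Z : Scheme.{u}} (r : Y ⟶ T) (a : Y ⟶ U.toScheme)
    (b : Y ⟶ V.toScheme) (h₀ : r ≫ d₀ = a ≫ U.ι) (h₁ : r ≫ d₁ = b ≫ V.ι) (f : T ⟶ Z) :
    overlapLift r a b h₀ h₁ ≫ (overlap d₀ d₁ U V).ι ≫ f = r ≫ f := by
  rw [← Category.assoc, overlapLift_ι]

end Overlap

variable {T X : Scheme.{u}} {d₀ d₁ : T ⟶ X}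

/-- Two projections with a schematically dominant common section agree over an affine open. -/
lemma overlapFst_eq_overlapSnd (ε : X ⟶ T) (h₀ : ε ≫ d₀ = 𝟙 X) (h₁ : ε ≫ d₁ = 𝟙 X)
    (hε : SchematicallyDominant ε) {U : X.Opens} (hU : IsAffineOpen U) :
    overlapFst d₀ d₁ U U = overlapSnd d₀ d₁ U U := by
  have : IsAffine U.toScheme := hU
  let V := overlap d₀ d₁ U U
  have key : (ε ∣_ V) ≫ overlapFst d₀ d₁ U U = (ε ∣_ V) ≫ overlapSnd d₀ d₁ U U := by
    rw [← cancel_mono U.ι]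
    simp [V, morphismRestrict_ι_assoc, h₀, h₁]
  -- The diagonal restricted to `V` acts on global functions as `ε.app V` followed by an
  -- isomorphism.
  have inj : Function.Injective (ε ∣_ V).appTop := by
    rw [Scheme.Hom.appTop, morphismRestrict_app]
    change Function.Injective (X.presheaf.map (eqToHom _).op ∘ ε.app _)
    refine Function.Injective.comp ?_ (hε _)
    exact (ConcreteCategory.bijective_of_isIso (X.presheaf.map (eqToHom _).op)).1
  refine ext_of_isAffine ?_
  ext x
  apply inj
  have := congr($(congr(Scheme.Hom.appTop $key)) x)
  simpa only [Scheme.Hom.comp_appTop, CommRingCat.comp_apply] using this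

section

variable (e : EquivalenceRelation d₀ d₁) (hε : SchematicallyDominant e.r)
include e hε

/-- Two relations with the same source compose, after inverting one, to a relation between their
targets. Both targets lie in the affine `V`, where related points are equal. -/
lemma overlap_hom_ext (U V : X.Opens) (hV : IsAffineOpen V) {Y : Scheme.{u}}
    {a b : Y ⟶ (overlap d₀ d₁ U V).toScheme}
    (h : a ≫ overlapFst d₀ d₁ U V = b ≫ overlapFst d₀ d₁ U V) : a = b := by
  rw [← cancel_mono (overlap d₀ d₁ U V).ι]
  have h' : a ≫ (overlap d₀ d₁ U V).ι ≫ d₀ = b ≫ (overlap d₀ d₁ U V).ι ≫ d₀ := by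
    simpa using congr($h ≫ U.ι)
  refine e.hom_ext (by simpa using h') ?_
  let w : Y ⟶ T := e.trans (a ≫ (overlap d₀ d₁ U V).ι ≫ e.s) (b ≫ (overlap d₀ d₁ U V).ι)
    (by simpa using h')
  let w' := overlapLift (d₀ := d₀) (d₁ := d₁) w (a ≫ overlapSnd d₀ d₁ U V)
    (b ≫ overlapSnd d₀ d₁ U V) (by simp [w]) (by simp [w])
  have := congr(w' ≫ $(overlapFst_eq_overlapSnd e.r e.reflexivity₁ e.reflexivity₂ hε hV) ≫ V.ι)
  simpa [w', w] using this

/-- A flat monomorphism locally of finite presentation is an open immersion. -/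
lemma isOpenImmersion_overlapFst (hd₀ : IsLocalIso d₀) (U V : X.Opens) (hV : IsAffineOpen V) :
    IsOpenImmersion (overlapFst d₀ d₁ U V) := by
  have : Mono (overlapFst d₀ d₁ U V) := ⟨fun _ _ h => overlap_hom_ext e hε U V hV h⟩
  have h : IsLocalIso ((overlap d₀ d₁ U V).ι ≫ d₀) :=
    IsZariskiLocalAtSource.comp hd₀ _
  have : Flat ((overlap d₀ d₁ U V).ι ≫ d₀) := flat_of_isLocalIso _ h
  have : LocallyOfFinitePresentation ((overlap d₀ d₁ U V).ι ≫ d₀) :=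
    locallyOfFinitePresentation_of_isLocalIso _ h
  have : Mono ((overlap d₀ d₁ U V).ι ≫ d₀) := by rw [← overlapFst_ι]; infer_instance
  have : IsOpenImmersion (overlapFst d₀ d₁ U V ≫ U.ι) := by
    rw [overlapFst_ι]
    exact .of_flat_of_mono _
  exact .of_comp _ U.ι

end

/-! ### The glueing datum -/

/-- The swap on overlaps. -/
noncomputable def overlapSwap (e : EquivalenceRelation d₀ d₁) (U V : X.Opens) :
    (overlap d₀ d₁ U V).toScheme ⟶ (overlap d₀ d₁ V U).toScheme :=
  overlapLift ((overlap d₀ d₁ U V).ι ≫ e.s) (overlapSnd d₀ d₁ U V) (overlapFst d₀ d₁ U V)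
    (by simp) (by simp)

@[simp]
lemma overlapSwap_ι (e : EquivalenceRelation d₀ d₁) (U V : X.Opens) :
    overlapSwap e U V ≫ (overlap d₀ d₁ V U).ι = (overlap d₀ d₁ U V).ι ≫ e.s :=
  overlapLift_ι _ _ _ _ _

@[simp]
lemma overlapSwap_ι_assoc (e : EquivalenceRelation d₀ d₁) (U V : X.Opens) {Z : Scheme.{u}}
    (f : T ⟶ Z) :
    overlapSwap e U V ≫ (overlap d₀ d₁ V U).ι ≫ f = (overlap d₀ d₁ U V).ι ≫ e.s ≫ f := by
  rw [← Category.assoc, overlapSwap_ι, Category.assoc]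

@[simp]
lemma overlapSwap_snd (e : EquivalenceRelation d₀ d₁) (U V : X.Opens) :
    overlapSwap e U V ≫ overlapSnd d₀ d₁ V U = overlapFst d₀ d₁ U V := by
  rw [← cancel_mono U.ι]; simp

@[simp]
lemma overlapSwap_fst (e : EquivalenceRelation d₀ d₁) (U V : X.Opens) :
    overlapSwap e U V ≫ overlapFst d₀ d₁ V U = overlapSnd d₀ d₁ U V := by
  rw [← cancel_mono V.ι]; simp

/-- The transition morphism on triple overlaps. -/
noncomputable def overlapTriple (e : EquivalenceRelation d₀ d₁) (U V W : X.Opens) :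
    pullback (overlapFst d₀ d₁ U V) (overlapFst d₀ d₁ U W) ⟶
      pullback (overlapFst d₀ d₁ V W) (overlapFst d₀ d₁ V U) :=
  have h : pullback.fst (overlapFst d₀ d₁ U V) (overlapFst d₀ d₁ U W) ≫
      (overlap d₀ d₁ U V).ι ≫ d₀ = pullback.snd _ _ ≫ (overlap d₀ d₁ U W).ι ≫ d₀ := by
    simpa using congr($(pullback.condition (f := overlapFst d₀ d₁ U V)
      (g := overlapFst d₀ d₁ U W)) ≫ U.ι)
  pullback.lift
    (overlapLift (e.trans (pullback.fst _ _ ≫ (overlap d₀ d₁ U V).ι ≫ e.s)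
        (pullback.snd _ _ ≫ (overlap d₀ d₁ U W).ι) (by simpa using h))
      (pullback.fst _ _ ≫ overlapSnd d₀ d₁ U V) (pullback.snd _ _ ≫ overlapSnd d₀ d₁ U W)
      (by simp) (by simp))
    (pullback.fst _ _ ≫ overlapSwap e U V)
    (by rw [← cancel_mono V.ι]; simp)

@[simp]
lemma overlapTriple_snd (e : EquivalenceRelation d₀ d₁) (U V W : X.Opens) :
    overlapTriple e U V W ≫ pullback.snd _ _ = pullback.fst _ _ ≫ overlapSwap e U V :=
  pullback.lift_snd _ _ _

@[simp]
lemma overlapTriple_snd_assoc (e : EquivalenceRelation d₀ d₁) (U V W : X.Opens) {Z : Scheme.{u}}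
    (f : (overlap d₀ d₁ V U).toScheme ⟶ Z) :
    overlapTriple e U V W ≫ pullback.snd _ _ ≫ f = pullback.fst _ _ ≫ overlapSwap e U V ≫ f := by
  rw [← Category.assoc, overlapTriple_snd, Category.assoc]

@[simp]
lemma overlapTriple_fst_ι_snd (e : EquivalenceRelation d₀ d₁) (U V W : X.Opens) :
    overlapTriple e U V W ≫ pullback.fst _ _ ≫ (overlap d₀ d₁ V W).ι ≫ d₁ =
      pullback.snd _ _ ≫ (overlap d₀ d₁ U W).ι ≫ d₁ := by
  rw [overlapTriple, pullback.lift_fst_assoc]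
  simp

@[simp]
lemma overlapTriple_fst_ι_fst (e : EquivalenceRelation d₀ d₁) (U V W : X.Opens) :
    overlapTriple e U V W ≫ pullback.fst _ _ ≫ (overlap d₀ d₁ V W).ι ≫ d₀ =
      pullback.fst _ _ ≫ (overlap d₀ d₁ U V).ι ≫ d₁ := by
  rw [overlapTriple, pullback.lift_fst_assoc]
  simp

/-- The glueing datum given by the affine opens of `X` and their overlaps in the relation. -/
noncomputable def glueData (e : EquivalenceRelation d₀ d₁) (hε : SchematicallyDominant e.r)
    (hd₀ : IsLocalIso d₀) : Scheme.GlueData.{u} where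
  J := X.affineOpens
  U i := i.1
  V ij := overlap d₀ d₁ ij.1.1 ij.2.1
  f i j := overlapFst d₀ d₁ i.1 j.1
  f_mono i j := ⟨fun _ _ h => overlap_hom_ext e hε _ _ j.2 h⟩
  f_hasPullback i j k := inferInstance
  f_open i j := isOpenImmersion_overlapFst e hε hd₀ _ _ j.2
  f_id i := by
    -- The diagonal is a section of the monomorphism `overlapFst`, which is therefore an
    -- isomorphism.
    let s := overlapLift (d₀ := d₀) (d₁ := d₁) (U := i.1) (V := i.1) (i.1.ι ≫ e.r) (𝟙 _) (𝟙 _)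
      (by simp) (by simp)
    have hs : s ≫ overlapFst d₀ d₁ i.1 i.1 = 𝟙 _ := by rw [← cancel_mono i.1.ι]; simp [s]
    exact ⟨s, overlap_hom_ext e hε _ _ i.2 (by simp [hs]), hs⟩
  t i j := overlapSwap e i.1 j.1
  t_id i := overlap_hom_ext e hε _ _ i.2 <| by
    simp [overlapFst_eq_overlapSnd e.r e.reflexivity₁ e.reflexivity₂ hε i.2]
  t' i j k := overlapTriple e i.1 j.1 k.1
  t_fac i j k := overlapTriple_snd _ _ _ _
  cocycle i j k := by
    -- Since these projections are monomorphisms, the cocycle identity need only be checked after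
    -- `d₀`.
    have : Mono (overlapFst d₀ d₁ i.1 k.1) := ⟨fun _ _ h => overlap_hom_ext e hε _ _ k.2 h⟩
    have : Mono (overlapFst d₀ d₁ i.1 j.1) := ⟨fun _ _ h => overlap_hom_ext e hε _ _ j.2 h⟩
    rw [← cancel_mono (pullback.fst _ _), ← cancel_mono (overlapFst d₀ d₁ i.1 j.1),
      ← cancel_mono i.1.ι]
    simp

/-! ### The glued scheme and its kernel pair -/

lemma exists_glue_of_isOpenCover {Y Z : Scheme.{u}} {J : Type u} (W : J → Y.Opens)
    (hW : TopologicalSpace.IsOpenCover W) (f : ∀ j, (W j).toScheme ⟶ Z)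
    (hf : ∀ (i j : J) {P : Scheme.{u}} (p : P ⟶ (W i).toScheme) (q : P ⟶ (W j).toScheme),
      p ≫ (W i).ι = q ≫ (W j).ι → p ≫ f i = q ≫ f j) :
    ∃ g : Y ⟶ Z, ∀ i, (W i).ι ≫ g = f i :=
  ⟨(Y.openCoverOfIsOpenCover W hW).glueMorphisms f fun i j => hf i j _ _ pullback.condition,
    fun i => Scheme.Cover.ι_glueMorphisms (Y.openCoverOfIsOpenCover W hW) _ _ i⟩

lemma hom_ext_of_isOpenCover {Y Z : Scheme.{u}} {J : Type u} (W : J → Y.Opens)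
    (hW : TopologicalSpace.IsOpenCover W) {f g : Y ⟶ Z}
    (h : ∀ j, (W j).ι ≫ f = (W j).ι ≫ g) : f = g :=
  (Y.openCoverOfIsOpenCover W hW).hom_ext _ _ h

section

variable (e : EquivalenceRelation d₀ d₁) (hε : SchematicallyDominant e.r) (hd₀ : IsLocalIso d₀)

/-- The chart of the glued quotient on an affine open. -/
noncomputable def chart (i : X.affineOpens) : i.1.toScheme ⟶ (glueData e hε hd₀).glued :=
  (glueData e hε hd₀).ι i

instance (i : X.affineOpens) : IsOpenImmersion (chart e hε hd₀ i) :=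
  (glueData e hε hd₀).ι_isOpenImmersion i

/-- Overlaps are the fibre products of charts over the glued scheme, and their points are exactly
relations with ends in the two opens. -/
lemma chart_condition_iff {Y : Scheme.{u}} {i j : X.affineOpens} (a : Y ⟶ i.1.toScheme)
    (b : Y ⟶ j.1.toScheme) :
    a ≫ chart e hε hd₀ i = b ≫ chart e hε hd₀ j ↔
      ∃ r : Y ⟶ T, r ≫ d₀ = a ≫ i.1.ι ∧ r ≫ d₁ = b ≫ j.1.ι := by
  constructor
  · intro h
    let v : Y ⟶ (overlap d₀ d₁ i.1 j.1).toScheme :=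
      PullbackCone.IsLimit.lift ((glueData e hε hd₀).vPullbackConeIsLimit i j) a b h
    have h₀ : v ≫ overlapFst d₀ d₁ i.1 j.1 = a :=
      PullbackCone.IsLimit.lift_fst ((glueData e hε hd₀).vPullbackConeIsLimit i j) a b h
    have h₁ : v ≫ overlapSwap e i.1 j.1 ≫ overlapFst d₀ d₁ j.1 i.1 = b :=
      PullbackCone.IsLimit.lift_snd ((glueData e hε hd₀).vPullbackConeIsLimit i j) a b h
    rw [overlapSwap_fst] at h₁
    exact ⟨v ≫ (overlap d₀ d₁ i.1 j.1).ι, by simp [← h₀], by simp [← h₁]⟩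
  · rintro ⟨r, h₀, h₁⟩
    let v := overlapLift r a b h₀ h₁
    have hv₀ : v ≫ overlapFst d₀ d₁ i.1 j.1 = a := by
      rw [← cancel_mono i.1.ι]; simp [v, h₀]
    have hv₁ : v ≫ overlapSnd d₀ d₁ i.1 j.1 = b := by
      rw [← cancel_mono j.1.ι]; simp [v, h₁]
    have key : overlapSwap e i.1 j.1 ≫ overlapFst d₀ d₁ j.1 i.1 ≫ chart e hε hd₀ j =
        overlapFst d₀ d₁ i.1 j.1 ≫ chart e hε hd₀ i :=
      (glueData e hε hd₀).glue_condition i j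
    rw [← Category.assoc, overlapSwap_fst] at key
    rw [← hv₀, ← hv₁, Category.assoc, Category.assoc, key]

include e hε hd₀ in
/-- A relation by local isomorphisms whose diagonal is schematically dominant is the kernel pair of
a surjective local isomorphism. -/
theorem exists_isPullback_isLocalIso : ∃ (E : Scheme.{u}) (h : X ⟶ E),
    IsLocalIso h ∧ Surjective h ∧ IsPullback d₀ d₁ h h := by
  have hcov := X.isBasis_affineOpens.isOpenCover
  obtain ⟨h, hh⟩ := exists_glue_of_isOpenCover (fun i : X.affineOpens => i.1) hcov
    (chart e hε hd₀) fun i j P p q hpq => (chart_condition_iff e hε hd₀ p q).2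
      -- Points that agree in `X` are related by reflexivity, so the charts agree on intersections.
      ⟨p ≫ i.1.ι ≫ e.r, by simp, by simpa using hpq⟩
  have mem (x : X) : ∃ i : X.affineOpens, x ∈ i.1 := hcov.exists_mem x
  refine ⟨_, h, ⟨fun x => ?_⟩, ⟨fun y => ?_⟩, ?_⟩
  · obtain ⟨i, hi⟩ := mem x
    exact ⟨i.1, hi, by rw [hh i]; infer_instance⟩
  · obtain ⟨i, z, rfl⟩ := (glueData e hε hd₀).ι_jointly_surjective y
    exact ⟨Scheme.Opens.ι _ z, congr($(hh i) z)⟩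
  · have w : d₀ ≫ h = d₁ ≫ h := by
      refine Scheme.hom_ext_of_forall _ _ fun t => ?_
      obtain ⟨i, hi⟩ := mem (d₀ t)
      obtain ⟨j, hj⟩ := mem (d₁ t)
      refine ⟨overlap d₀ d₁ i.1 j.1, ⟨hi, hj⟩, ?_⟩
      rw [← overlapFst_ι_assoc, ← overlapSnd_ι_assoc, hh i, hh j, chart_condition_iff]
      exact ⟨_, (overlapFst_ι _ _ _ _).symm, (overlapSnd_ι _ _ _ _).symm⟩
    have lift {Y : Scheme.{u}} (a b : Y ⟶ X) (hab : a ≫ h = b ≫ h) :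
        ∃ r : Y ⟶ T, r ≫ d₀ = a ∧ r ≫ d₁ = b := by
      let W (k : X.affineOpens × X.affineOpens) : Y.Opens := overlap a b k.1.1 k.2.1
      have hW : TopologicalSpace.IsOpenCover W := by
        refine .mk (eq_top_iff.2 fun y _ => ?_)
        obtain ⟨i, hi⟩ := mem (a y)
        obtain ⟨j, hj⟩ := mem (b y)
        exact TopologicalSpace.Opens.mem_iSup.2 ⟨(i, j), hi, hj⟩
      have hloc (k : X.affineOpens × X.affineOpens) : ∃ r : (W k).toScheme ⟶ T,
          r ≫ d₀ = (W k).ι ≫ a ∧ r ≫ d₁ = (W k).ι ≫ b := by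
        have := (chart_condition_iff e hε hd₀ (overlapFst a b k.1.1 k.2.1)
          (overlapSnd a b k.1.1 k.2.1)).1 (by rw [← hh, ← hh]; simp [hab])
        simpa using this
      choose r hr₀ hr₁ using hloc
      -- Local relations glue because a relation is determined by its two ends.
      obtain ⟨g, hg⟩ := exists_glue_of_isOpenCover W hW r fun i j P p q hpq => e.hom_ext
        (by simp only [Category.assoc, hr₀]; simp only [← Category.assoc, hpq])
        (by simp only [Category.assoc, hr₁]; simp only [← Category.assoc, hpq])
      refine ⟨g, ?_, ?_⟩
      · refine hom_ext_of_isOpenCover W hW fun k => ?_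
        rw [← hr₀, ← hg, Category.assoc]
      · refine hom_ext_of_isOpenCover W hW fun k => ?_
        rw [← hr₁, ← hg, Category.assoc]
    refine ⟨⟨w⟩, ⟨PullbackCone.IsLimit.mk w (fun s => (lift s.fst s.snd s.condition).choose)
      (fun s => (lift s.fst s.snd s.condition).choose_spec.1)
      (fun s => (lift s.fst s.snd s.condition).choose_spec.2) fun s m h₀ h₁ => ?_⟩⟩
    have hs := (lift s.fst s.snd s.condition).choose_spec
    exact e.hom_ext (h₀.trans hs.1.symm) (h₁.trans hs.2.symm)

end

/-- Quasi-compactness descends along a local isomorphism to its own kernel pair. -/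
lemma quasiCompact_of_isPullback {E : Scheme.{u}} {h : X ⟶ E} [IsLocalIso h] [Surjective h]
    (hp : IsPullback d₀ d₁ h h) (hd : QuasiCompact d₁) : QuasiCompact h := by
  choose U hxU hU using fun x : X => IsLocalIso.exists_isOpenImmersion (f := h) x
  have (x : X) : IsOpenImmersion ((U x).ι ≫ h) := hU x
  let 𝒰 : E.OpenCover :=
    { I₀ := X
      X x := (U x).toScheme
      f x := (U x).ι ≫ h
      mem₀ := by
        rw [Scheme.presieve₀_mem_precoverage_iff]
        refine ⟨fun y => ?_, inferInstance⟩
        obtain ⟨x, rfl⟩ := h.surjective y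
        exact ⟨x, ⟨x, hxU x⟩, rfl⟩ }
  have : IsZariskiLocalAtTarget @QuasiCompact :=
    @HasAffineProperty.instIsZariskiLocalAtTarget _ _
      instHasAffinePropertyQuasiCompactCompactSpaceCarrierCarrierCommRingCat
  refine (IsZariskiLocalAtTarget.iff_of_openCover (P := @QuasiCompact) 𝒰).2 fun x => ?_
  have hp' := (IsPullback.of_hasPullback h ((U x).ι ≫ h))
  -- By pasting with the kernel pair square, the base change of `h` to a chart is also the base
  -- change of `d₁` along `(U x).ι`.
  have : IsPullback (hp.lift (pullback.fst h ((U x).ι ≫ h))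
      (pullback.snd h ((U x).ι ≫ h) ≫ (U x).ι) (by simp [pullback.condition]))
      (pullback.snd h ((U x).ι ≫ h)) d₁ (U x).ι :=
    IsPullback.of_right (by simpa using hp') (by simp) hp
  exact MorphismProperty.of_isPullback (P := @QuasiCompact) this hd

/-! ### Representing the fppf quotient sheaf -/

/-- A locally bijective morphism to a sheaf identifies its target with the sheafification. -/
lemma exists_iso_sheafify_of_W {C : Type*} [Category* C] (J : GrothendieckTopology C) {A : Type*}
    [Category* A] [HasWeakSheafify J A] {P Q : Cᵒᵖ ⥤ A} (φ : P ⟶ Q) (hφ : J.W φ)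
    (hQ : Presheaf.IsSheaf J Q) :
    ∃ ψ : Q ≅ ((presheafToSheaf J A).obj P).obj, φ ≫ ψ.hom = toSheafify J P := by
  have : IsIso ((presheafToSheaf J A).map φ) := (J.W_iff φ).1 hφ
  have : IsIso (sheafifyMap J φ) :=
    inferInstanceAs (IsIso ((sheafToPresheaf J A).map ((presheafToSheaf J A).map φ)))
  refine ⟨isoSheafify J hQ ≪≫ (asIso (sheafifyMap J φ)).symm, ?_⟩
  change φ ≫ toSheafify J Q ≫ inv (sheafifyMap J φ) = _
  rw [← Category.assoc, IsIso.comp_inv_eq, toSheafify_naturality]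

variable {S : Scheme.{u}} {T₀ T₁ : Over S} {d₀ d₁ : T₁ ⟶ T₀}

/-- Agreement after `d₀.left` already forces equal structure morphisms to `S`, so a pair of scheme
morphisms lifts to a pair over `S`. -/
lemma jointlyMono₂_left (R : EquivalenceRelation d₀ d₁) : JointlyMono₂ d₀.left d₁.left where
  right_cancellation Y f g h₀ h₁ := by
    have hw : g ≫ T₁.hom = f ≫ T₁.hom := by
      rw [← Over.w d₀, ← Category.assoc, ← Category.assoc, h₀]
    have := R.hom_ext (f := (Over.homMk f : Over.mk (f ≫ T₁.hom) ⟶ T₁))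
      (g := Over.homMk g hw) (by ext; exact h₀) (by ext; exact h₁)
    exact congr(($this).left)

section

variable {E : Over S} (h : T₀ ⟶ E) (w : d₀ ≫ h = d₁ ≫ h)

/-- The morphism from the presheaf quotient induced by an invariant morphism. -/
def quotientToYoneda : quotientPresheafLarge d₀ d₁ ⟶ uliftYoneda.{u + 1}.obj E where
  app X := ↾fun q => ULift.up (Quot.lift (fun a : X.unop ⟶ T₀ => a ≫ h) (by
    rintro a b ⟨r, rfl, rfl⟩
    simp [w]) q.down)
  naturality X Y f := by
    ext ⟨q⟩
    induction q using Quot.ind with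
    | mk a => exact congrArg ULift.up (Category.assoc f.unop a h)

lemma quotientToYoneda_injective
    (hk : ∀ {X : Over S} (a b : X ⟶ T₀), a ≫ h = b ≫ h → pointRel d₀ d₁ X a b)
    (X : (Over S)ᵒᵖ) : Function.Injective ((quotientToYoneda h w).app X) := by
  rintro ⟨p⟩ ⟨q⟩ hpq
  induction p using Quot.ind with
  | mk a =>
    induction q using Quot.ind with
    | mk b => exact congrArg ULift.up (Quot.sound (hk a b (congrArg ULift.down hpq)))

/-- A point of `E` lifts to `T₀` after pulling back along `h`, and this pullback is a one-element
fppf covering. -/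
lemma isLocallySurjective_quotientToYoneda [Surjective h.left] [Flat h.left]
    [LocallyOfFinitePresentation h.left] :
    Presheaf.IsLocallySurjective (fppfOver S) (quotientToYoneda h w) where
  imageSieve_mem {X} s := by
    rw [GrothendieckTopology.mem_over_iff]
    let s' : X ⟶ E := s.down
    refine GrothendieckTopology.superset_covering _ ?_
      (Precoverage.generate_mem_toGrothendieck
        (Scheme.Hom.singleton_mem_fppfPrecoverage (pullback.fst s'.left h.left)))
    rw [Sieve.generate_le_iff]
    rintro _ _ ⟨⟩
    rw [Sieve.overEquiv_iff]
    refine ⟨ULift.up (Quot.mk _ (Over.homMk (pullback.snd s'.left h.left) ?_)), ?_⟩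
    · have := congr($(pullback.condition (f := s'.left) (g := h.left)) ≫ E.hom)
      simpa using this.symm
    · refine congrArg ULift.up ?_
      exact Over.OverMorphism.ext pullback.condition.symm

include w in
/-- An fppf covering with kernel pair the given relation represents the fppf quotient. -/
theorem exists_representableBy_canonicalMap_eq [Surjective h.left] [Flat h.left]
    [LocallyOfFinitePresentation h.left]
    (hk : ∀ {X : Over S} (a b : X ⟶ T₀), a ≫ h = b ≫ h → pointRel d₀ d₁ X a b) :
    ∃ ρ : (fppfQuotient d₀ d₁).obj.RepresentableBy E, canonicalMap d₀ d₁ ρ = h := by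
  have : Presheaf.IsLocallyInjective (fppfOver S) (quotientToYoneda h w) :=
    Presheaf.isLocallyInjective_of_injective _ _ (quotientToYoneda_injective h w hk)
  have := isLocallySurjective_quotientToYoneda h w
  obtain ⟨ψ, hψ⟩ := exists_iso_sheafify_of_W (fppfOver S) (quotientToYoneda h w)
    ((fppfOver S).W_of_isLocallyBijective _)
    ((GrothendieckTopology.uliftYoneda.{u + 1} (fppfOver S)).obj E).property
  let ρ : (fppfQuotient d₀ d₁).obj.RepresentableBy E :=
    { homEquiv {X} := Equiv.ulift.symm.trans (ψ.app (op X)).toEquiv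
      homEquiv_comp f g := congr($(ψ.hom.naturality f.op) (ULift.up.{u + 1} g)) }
  refine ⟨ρ, ρ.homEquiv.symm_apply_eq.2 ?_⟩
  -- Evaluate at the universal point: `quotientToYoneda` sends the class of `𝟙 T₀` to `h`.
  have := congr($(congr(($hψ).app (op T₀))) (ULift.up (Quot.mk _ (𝟙 T₀))))
  refine this.symm.trans ?_
  exact congrArg (fun f => ψ.hom.app (op T₀) (ULift.up f)) (Category.id_comp h)

end

end SchemeQuotient

theorem mainTheorem8 {S : Scheme.{u}} {T₀ T₁ : Over S} (d₀ d₁ : T₁ ⟶ T₀)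
    (R : EquivalenceRelation d₀ d₁)
    (hε : SchemeQuotient.SchematicallyDominant R.r.left)
    (hd₀ : IsLocalIso d₀.left) (hd₁ : IsLocalIso d₁.left) :
    ∃ (E : Over S) (ρ : (SchemeQuotient.fppfQuotient d₀ d₁).obj.RepresentableBy E),
      IsLocalIso (SchemeQuotient.canonicalMap d₀ d₁ ρ).left ∧
      (QuasiCompact d₀.left → QuasiCompact d₁.left →
        QuasiCompact (SchemeQuotient.canonicalMap d₀ d₁ ρ).left) := by
  have : JointlyMono₂ ((Over.forget S).map d₀) ((Over.forget S).map d₁) :=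
    SchemeQuotient.jointlyMono₂_left R
  obtain ⟨E, h, hh, hs, hp⟩ :=
    SchemeQuotient.exists_isPullback_isLocalIso (d₀ := d₀.left) (d₁ := d₁.left)
      (R.map (Over.forget S)) hε hd₀
  have := SchemeQuotient.flat_of_isLocalIso h hh
  have := SchemeQuotient.locallyOfFinitePresentation_of_isLocalIso h hh
  have inv {Z : Scheme.{u}} (a b : Z ⟶ T₀.left) (hab : a ≫ h = b ≫ h) :
      a ≫ T₀.hom = b ≫ T₀.hom := by
    obtain ⟨r, rfl, rfl⟩ := hp.exists_lift a b hab
    simp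
  -- The glueing took place in absolute schemes. As an effective epimorphism, `h` lets the structure
  -- morphism of `T₀`, which is constant on related points, descend to `E`.
  let q : E ⟶ S := EffectiveEpi.desc h T₀.hom inv
  let h' : T₀ ⟶ Over.mk q := Over.homMk h (EffectiveEpi.fac h T₀.hom inv)
  have : IsLocalIso h'.left := hh
  have : Surjective h'.left := hs
  have : Flat h'.left := ‹_›
  have : LocallyOfFinitePresentation h'.left := ‹_›
  obtain ⟨ρ, hρ⟩ := SchemeQuotient.exists_representableBy_canonicalMap_eq (d₀ := d₀) (d₁ := d₁) h'
    (by ext; exact hp.w) fun {X} a b hab =>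
      ⟨Over.homMk (hp.lift a.left b.left congr(($hab).left)) (by
        rw [← Over.w d₀, ← Over.w a]
        exact hp.lift_fst_assoc _ _ _ _), by ext; exact hp.lift_fst _ _ _,
        by ext; exact hp.lift_snd _ _ _⟩
  refine ⟨_, ρ, ?_⟩
  rw [hρ]
  exact ⟨hh, fun _ hq => SchemeQuotient.quasiCompact_of_isPullback hp hq⟩
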